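/- **Proposition 7.4.** Let $T\in(0,\infty)$ and let $b:\mathbb{R}^2\to\mathbb{R}^2$ be an autonomous Borel vector field with $b\in BV_{\rm loc}(\mathbb{R}^2;\mathbb{R}^2)$ and distributional divergence $\operatorname{div} b\in L^\infty_{\rm loc}(\mathbb{R}^2)$. Let $X$ be a maximal regular flow of $b$ in $\mathbb{R}^2$ on the time interval $[0,T]$, with maximal time $T_X$. Then $$\liminf_{t\uparrow T_X(x)}|X(t,x)|=\infty\qquad\text{for a.e. } x\in\mathbb{R}^2\text{ such that }\limsup_{t\uparrow T_X(x)}|X(t,x)|=\infty .$$ Here a *maximal regular flow* of $b$ in $\mathbb{R}^2$ consists of a Borel map $T_X:\mathbb{R}^2\to(0,T]$ and a Borel map $X(t,x)\in\mathbb{R}^2$ defined for $0\le t<T_X(x)$ such that: 1. for a.e. $x$, the curve $X(\cdot,x)$ is absolutely continuous on $[0,t]$ for every $t<T_X(x)$, $X(0,x)=x$, and $\frac{d}{dt}X(t,x)=b(X(t,x))$ for a.e. $t\in(0,T_X(x))$; 2. for every bounded open set $\Omega'\subset\mathbb{R}^2$ there is a constant $C$ such that, for all $t\in[0,T]$, the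 push-forward under $X(t,\cdot)$ of Lebesgue measure restricted to $\{T_{\Omega'}>t\}$ is at most $C$ times Lebesgue measure restricted to $\Omega'$; here $T_{\Omega'}(x)=\sup\{t\in[0,T_X(x)):\ X([0,t],x)\subset\Omega'\}$ for $x\in\Omega'$ (with $\sup\emptyset=0$) and $T_{\Omega'}(x)=0$ for $x\notin\Omega'$; 3. $\limsup_{t\uparrow T_X(x)}|X(t,x)|=\infty$ for a.e. $x$ with $T_X(x)<T$. -/

import Mathlib

open MeasureTheory Filter Set Topology
open scoped ENNReal NNReal

noncomputable section

/-- The divergence `∑ i, ∂ᵢ φᵢ` of a (differentiable) vector field on `ℝᵈ`. -/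
def divergence {d : ℕ} (φ : EuclideanSpace ℝ (Fin d) → EuclideanSpace ℝ (Fin d))
    (x : EuclideanSpace ℝ (Fin d)) : ℝ :=
  ∑ i, (fderiv ℝ φ x (EuclideanSpace.single i 1)) i

/-- `A ⋐ Ω` for open sets: the closure of `A` is compact and contained in `Ω`. -/
def CompactlyInside {d : ℕ} (A Ω : Set (EuclideanSpace ℝ (Fin d))) : Prop :=
  IsOpen A ∧ IsCompact (closure A) ∧ closure A ⊆ Ω

/-- `f ∈ BV_loc(ℝᵈ)`: `f` is locally integrable and, for every open `A ⋐ ℝᵈ`, the variation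
`sup {∫ f div φ : φ ∈ C¹_c(A; ℝᵈ), |φ| ≤ 1}` is finite. -/
def IsBVLoc {d : ℕ} (f : EuclideanSpace ℝ (Fin d) → ℝ) : Prop :=
  LocallyIntegrable f volume ∧
  ∀ A : Set (EuclideanSpace ℝ (Fin d)), CompactlyInside A univ →
    ∃ M : ℝ, ∀ φ : EuclideanSpace ℝ (Fin d) → EuclideanSpace ℝ (Fin d),
      ContDiff ℝ 1 φ → HasCompactSupport φ → tsupport φ ⊆ A → (∀ x, ‖φ x‖ ≤ 1) →
        ∫ x, f x * divergence φ x ≤ M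

/-- `b ∈ BV_loc(ℝᵈ; ℝᵐ)`: every component of `b` is in `BV_loc(ℝᵈ)`. -/
def IsBVLocField {d m : ℕ} (b : EuclideanSpace ℝ (Fin d) → EuclideanSpace ℝ (Fin m)) : Prop :=
  ∀ i, IsBVLoc (fun x => b x i)

/-- `g` is the distributional divergence of the vector field `b`:
`∫ b · ∇φ = - ∫ g φ` for every `φ ∈ C^∞_c(ℝᵈ)`. -/
def IsDistribDiv {d : ℕ} (b : EuclideanSpace ℝ (Fin d) → EuclideanSpace ℝ (Fin d))
    (g : EuclideanSpace ℝ (Fin d) → ℝ) : Prop :=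
  ∀ φ : EuclideanSpace ℝ (Fin d) → ℝ, ContDiff ℝ (⊤ : ℕ∞) φ → HasCompactSupport φ →
    ∫ x, fderiv ℝ φ x (b x) = - ∫ x, g x * φ x

/-- `div b ∈ L^∞_loc(ℝᵈ)`: the distributional divergence of `b` is a function which is
essentially bounded on every compact set. -/
def HasDivLInftyLoc {d : ℕ} (b : EuclideanSpace ℝ (Fin d) → EuclideanSpace ℝ (Fin d)) : Prop :=
  ∃ g : EuclideanSpace ℝ (Fin d) → ℝ,
    (∀ K : Set (EuclideanSpace ℝ (Fin d)), IsCompact K → MemLp g ∞ (volume.restrict K)) ∧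
    IsDistribDiv b g

/-- The potential `V_Ω(x) = max {dist(x, ℝᵈ ∖ Ω)⁻¹, |x|}` of an open set `Ω`, which is continuous
and finite in `Ω` and tends to `∞` at the boundary of `Ω`; it is extended by `∞` outside `Ω`.
For `Ω = ℝᵈ` the distance is `∞` and `V_Ω(x) = |x|`. -/
def potential {d : ℕ} (Ω : Set (EuclideanSpace ℝ (Fin d))) (x : EuclideanSpace ℝ (Fin d)) :
    ℝ≥0∞ :=
  max (Metric.infEDist x Ωᶜ)⁻¹ ‖x‖ₑ

/-- The hitting time in `Ω` of a continuous curve `η : [0, τ) → ℝᵈ`, namely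
`sup {t ∈ [0, τ) : max_{[0,t]} V_Ω(η) < ∞}`; it is `0` if `η 0 ∉ Ω`, since the set is then empty. -/
def hittingTime {d : ℕ} (Ω : Set (EuclideanSpace ℝ (Fin d))) (τ : ℝ)
    (η : ℝ → EuclideanSpace ℝ (Fin d)) : ℝ :=
  sSup {t : ℝ | 0 ≤ t ∧ t < τ ∧ (⨆ s ∈ Icc 0 t, potential Ω (η s)) < ∞}

open Classical in
/-- The time `T_{Ω'}(x)` at which the trajectory `X(·, x)`, defined on `[0, TX x)`, leaves `Ω'`;
it is `0` for `x ∉ Ω'`. -/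
def exitTime {d : ℕ} (X : ℝ → EuclideanSpace ℝ (Fin d) → EuclideanSpace ℝ (Fin d))
    (TX : EuclideanSpace ℝ (Fin d) → ℝ) (Ω' : Set (EuclideanSpace ℝ (Fin d)))
    (x : EuclideanSpace ℝ (Fin d)) : ℝ :=
  if x ∈ Ω' then hittingTime Ω' (TX x) (fun t => X t x) else 0

/-- `X` is a maximal regular flow in the open set `Ω`, relative to the vector field
`b : (0, T) × Ω → ℝᵈ`, with maximal time `TX : Ω → (0, T]`. The map `X` is only meaningful on
`{(t, x) : x ∈ Ω, 0 ≤ t < TX x}`; the values of `X`, `TX`, `b` elsewhere are irrelevant. -/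
structure IsMaximalRegularFlow {d : ℕ}
    (b : ℝ → EuclideanSpace ℝ (Fin d) → EuclideanSpace ℝ (Fin d)) (T : ℝ)
    (Ω : Set (EuclideanSpace ℝ (Fin d)))
    (X : ℝ → EuclideanSpace ℝ (Fin d) → EuclideanSpace ℝ (Fin d))
    (TX : EuclideanSpace ℝ (Fin d) → ℝ) : Prop where
  /-- `TX` is Borel on `Ω`. -/
  measurable_time : Measurable (fun x : Ω => TX x)
  /-- `TX` takes values in `(0, T]`. -/
  time_mem : ∀ x ∈ Ω, TX x ∈ Ioc 0 T
  /-- `X` is Borel on its domain of definition. -/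
  measurable_flow : Measurable
    (fun p : {p : ℝ × EuclideanSpace ℝ (Fin d) // p.2 ∈ Ω ∧ 0 ≤ p.1 ∧ p.1 < TX p.2} =>
      X p.1.1 p.1.2)
  /-- For a.e. `x ∈ Ω`, `X(·, x)` is a curve in `Ω`, locally absolutely continuous on
  `[0, TX x)`, which starts at `x` and solves the differential equation a.e. in `(0, TX x)`. -/
  integral_curve : ∀ᵐ x ∂(volume.restrict Ω),
    (∀ t ∈ Ico 0 (TX x), X t x ∈ Ω) ∧
    (∀ t ∈ Ico 0 (TX x), AbsolutelyContinuousOnInterval (fun s => X s x) 0 t) ∧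
    (∀ᵐ t ∂(volume.restrict (Ioo 0 (TX x))), HasDerivAt (fun s => X s x) (b t (X t x)) t) ∧
    X 0 x = x
  /-- Local bounded compression. -/
  compression : ∀ Ω' : Set (EuclideanSpace ℝ (Fin d)), CompactlyInside Ω' Ω →
    ∃ C : ℝ≥0, ∀ t ∈ Icc 0 T,
      Measure.map (X t) (volume.restrict {x | t < exitTime X TX Ω' x})
        ≤ (C : ℝ≥0∞) • volume.restrict Ω'
  /-- Trajectories whose life time is shorter than `T` are unbounded in terms of the potential. -/
  blow_up : ∀ᵐ x ∂(volume.restrict Ω), TX x < T →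
    limsup (fun t => potential Ω (X t x)) (𝓝[<] (TX x)) = ∞

end

/-!
Write `ρ(z) = max |z₀| |z₁|` for the sup norm of the plane. The reason that a trajectory cannot
oscillate is that, although `b` need not be locally bounded, the speed at which a trajectory can
move outwards across a square is bounded for a set of squares of positive measure, so that every
crossing of a shell `R ≤ ρ ≤ R + 1` costs a fixed amount of time.

*Slices.* The restriction of a `BV` function of two variables to almost every line is a `BV`
function of one variable, hence essentially bounded on bounded segments
(`IsBVLoc.ae_exists_slice_bound`). Here this is obtained by mollification: testing the variation
with a mollified sign bounds the `L¹` norm of the partial derivatives of the mollifications uniformly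
(`IsBVLoc.exists_lintegral_fderiv_convolution_le`), and Fatou's lemma gives, on almost every line,
a finite bound on the oscillation of the limit. Consequently there are `n` and a compact set
`K ⊆ [R, R + 1]` of positive measure such that at almost every point of the squares `ρ = r`, `r ∈ K`,
the normal component of `b` is at most `n` (`IsBVLocField.exists_isCompact_bounded_slices`).

*Trajectories.* By bounded compression, almost every trajectory spends no time in a given null set
(`IsMaximalRegularFlow.ae_ae_notMem_of_null`), so it sees that bound at almost every time. Let
`F(s) = |K ∩ (-∞, s]|`. As `F` is `1`-Lipschitz and locally constant off `K`, the absolutely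
continuous function `t ↦ F(ρ(X(t, x)))` has derivative at most `n` almost everywhere, hence is
`n`-Lipschitz (`abs_leftMeasure_planeSupNorm_sub_le`). But `F(ρ) = 0` for `ρ < R` and `F(ρ) = |K| > 0`
for `ρ > R + 1`, so that the trajectory cannot visit both regions at times arbitrarily close to
the finite time `T_X(x)`.
-/

/-! ### Mollifications of functions of locally bounded variation -/

open scoped Convolution in
lemma fderiv_normed_convolution_apply {d : ℕ} (φ : ContDiffBump (0 : EuclideanSpace ℝ (Fin d)))
    {f : EuclideanSpace ℝ (Fin d) → ℝ} (hf : LocallyIntegrable f volume)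
    (x v : EuclideanSpace ℝ (Fin d)) :
    fderiv ℝ (φ.normed volume ⋆[ContinuousLinearMap.lsmul ℝ ℝ, volume] f) x v =
      ∫ t, fderiv ℝ (φ.normed volume) (x - t) v * f t := by
  have hφ : ContDiff ℝ 1 (φ.normed volume) := φ.contDiff_normed (n := 1)
  have hex : ConvolutionExistsAt (fderiv ℝ (φ.normed volume)) f x
      ((ContinuousLinearMap.lsmul ℝ ℝ).precompL (EuclideanSpace ℝ (Fin d))) volume :=
    (φ.hasCompactSupport_normed.fderiv (𝕜 := ℝ)).convolutionExists_left _
      (hφ.continuous_fderiv one_ne_zero) hf x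
  rw [(φ.hasCompactSupport_normed.hasFDerivAt_convolution_left (ContinuousLinearMap.lsmul ℝ ℝ)
    hφ hf x).fderiv, convolution_def, ContinuousLinearMap.integral_apply hex.integrable,
    ← integral_sub_left_eq_self _ _ x]
  simp

lemma fderiv_normed_neg {d : ℕ} (φ : ContDiffBump (0 : EuclideanSpace ℝ (Fin d)))
    (x v : EuclideanSpace ℝ (Fin d)) :
    fderiv ℝ (φ.normed volume) (-x) v = -fderiv ℝ (φ.normed volume) x v := by
  have h : (fun y => φ.normed volume (-y)) = φ.normed volume := by
    ext y; exact φ.normed_neg y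
  have h1 : HasFDerivAt (fun y => φ.normed volume (-y))
      ((fderiv ℝ (φ.normed volume) (-x)).comp (-ContinuousLinearMap.id ℝ _)) x :=
    ((φ.contDiff_normed (n := 1)).differentiable one_ne_zero (-x)).hasFDerivAt.comp x
      (hasFDerivAt_id x).neg
  rw [h] at h1
  rw [h1.fderiv]
  simp

lemma divergence_smul_single {d : ℕ} {u : EuclideanSpace ℝ (Fin d) → ℝ} (hu : Differentiable ℝ u)
    (j : Fin d) (x : EuclideanSpace ℝ (Fin d)) :
    divergence (fun z => u z • EuclideanSpace.single j (1 : ℝ)) x =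
      fderiv ℝ u x (EuclideanSpace.single j 1) := by
  unfold divergence
  rw [fderiv_smul_const (hu x)]
  simp

open scoped Convolution in
/-- The partial derivatives of the mollifications of a `BV_loc` function are bounded in `L¹` on each
ball, uniformly in the mollifier. The bound is the variation on a slightly larger ball: the integral
of `|∂ⱼ(φ ⋆ f)|` over the ball is `∫ f div(-(φ ⋆ ψ) eⱼ)`, where `ψ` is the sign of `∂ⱼ(φ ⋆ f)` on the
ball and `0` elsewhere. -/
lemma IsBVLoc.exists_lintegral_fderiv_convolution_le {d : ℕ} {f : EuclideanSpace ℝ (Fin d) → ℝ}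
    (hf : IsBVLoc f) (j : Fin d) (R : ℝ) :
    ∃ M : ℝ, ∀ φ : ContDiffBump (0 : EuclideanSpace ℝ (Fin d)), φ.rOut ≤ 1 →
      ∫⁻ x in Metric.ball 0 R,
        ‖fderiv ℝ (φ.normed volume ⋆[ContinuousLinearMap.lsmul ℝ ℝ, volume] f) x
          (EuclideanSpace.single j 1)‖ₑ ≤ ENNReal.ofReal M := by
  obtain ⟨M, hM⟩ := hf.2 (Metric.ball 0 (R + 2)) ⟨Metric.isOpen_ball,
    (isCompact_closedBall 0 (R + 2)).of_isClosed_subset isClosed_closure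
      Metric.closure_ball_subset_closedBall, subset_univ _⟩
  refine ⟨M, fun φ hφ => ?_⟩
  have hφc : ContDiff ℝ 1 (φ.normed volume) := φ.contDiff_normed (n := 1)
  set v : EuclideanSpace ℝ (Fin d) := EuclideanSpace.single j 1 with hv
  set k : EuclideanSpace ℝ (Fin d) → ℝ := fun x => fderiv ℝ (φ.normed volume) x v with hk
  have hkc : Continuous k := (hφc.continuous_fderiv one_ne_zero).clm_apply continuous_const
  obtain ⟨C, hC⟩ : ∃ C, ∀ x, ‖k x‖ ≤ C := by
    refine HasCompactSupport.exists_bound_of_continuous ?_ hkc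
    exact (φ.hasCompactSupport_normed.fderiv_apply (𝕜 := ℝ) v)
  set g : EuclideanSpace ℝ (Fin d) → ℝ := fun x =>
    fderiv ℝ (φ.normed volume ⋆[ContinuousLinearMap.lsmul ℝ ℝ, volume] f) x v with hg
  have hgc : Continuous g :=
    ((φ.hasCompactSupport_normed.contDiff_convolution_left (ContinuousLinearMap.lsmul ℝ ℝ)
      hφc hf.1).continuous_fderiv one_ne_zero).clm_apply continuous_const
  set ψ : EuclideanSpace ℝ (Fin d) → ℝ :=
    (Metric.ball 0 R).indicator (fun x => if 0 ≤ g x then 1 else -1) with hψ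
  have hψm : Measurable ψ := by
    refine Measurable.indicator ?_ measurableSet_ball
    exact Measurable.ite (measurableSet_le measurable_const hgc.measurable)
      measurable_const measurable_const
  have hψ1 : ∀ x, ‖ψ x‖ ≤ (Metric.ball (0 : EuclideanSpace ℝ (Fin d)) R).indicator 1 x := by
    intro x
    simp only [hψ, indicator]
    split_ifs <;> simp
  have hball : IntegrableOn (1 : EuclideanSpace ℝ (Fin d) → ℝ) (Metric.ball 0 R) volume := by
    exact integrableOn_const measure_ball_lt_top.ne
  have hψi : Integrable ψ volume :=
    ((integrable_indicator_iff measurableSet_ball).2 hball).mono' hψm.aestronglyMeasurable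
      (Eventually.of_forall hψ1)
  set Φ : EuclideanSpace ℝ (Fin d) → ℝ :=
    φ.normed volume ⋆[ContinuousLinearMap.lsmul ℝ ℝ, volume] ψ with hΦ
  have hΦc : ContDiff ℝ 1 Φ := φ.hasCompactSupport_normed.contDiff_convolution_left
      (ContinuousLinearMap.lsmul ℝ ℝ) hφc hψi.locallyIntegrable
  have hΦ1 : ∀ x, ‖Φ x‖ ≤ 1 := by
    intro x
    have := dist_convolution_le (μ := volume) (g := ψ) (x₀ := x) (z₀ := 0) zero_le_one
      φ.support_normed_eq.le φ.nonneg_normed φ.integral_normed hψm.aestronglyMeasurable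
      (fun y _ => by
        rw [dist_zero_right]
        exact (hψ1 y).trans (indicator_le_self' (by simp) y |>.trans (by simp)))
    simpa using this
  have hΦs : tsupport Φ ⊆ Metric.closedBall 0 (R + 1) := by
    refine closure_minimal ?_ Metric.isClosed_closedBall
    refine (support_convolution_subset _).trans ?_
    rintro _ ⟨a, ha, c, hc, rfl⟩
    rw [φ.support_normed_eq, mem_ball_zero_iff] at ha
    have hc' : c ∈ Metric.ball (0 : EuclideanSpace ℝ (Fin d)) R := by
      by_contra h
      exact hc (indicator_of_notMem h _)
    rw [mem_ball_zero_iff] at hc'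
    rw [mem_closedBall_zero_iff]
    exact (norm_add_le _ _).trans (by linarith)
  have hΦcs : HasCompactSupport Φ :=
    (isCompact_closedBall _ _).of_isClosed_subset (isClosed_tsupport _) hΦs
  -- `-Φ e_j` is an admissible test field
  have htest := hM (fun z => (-Φ z) • v) (hΦc.neg.smul contDiff_const)
    ((hΦcs.neg).smul_right)
    ((closure_mono (fun z hz => by
      simp only [Function.mem_support, ne_eq, smul_eq_zero, neg_eq_zero, not_or] at hz
      exact hz.1)).trans (hΦs.trans (Metric.closedBall_subset_ball (by linarith))))
    (fun x => by simpa [norm_smul, hv] using hΦ1 x)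
  have hdivΦ : ∀ z, divergence (fun z => (-Φ z) • v) z = ∫ x, k (x - z) * ψ x := by
    intro z
    rw [divergence_smul_single (hΦc.neg.differentiable one_ne_zero)]
    have : fderiv ℝ (fun z => -Φ z) z = -fderiv ℝ Φ z := fderiv_neg
    rw [this, neg_apply,
      fderiv_normed_convolution_apply φ hψi.locallyIntegrable, ← integral_neg]
    refine integral_congr_ae (Eventually.of_forall fun x => ?_)
    simp only [hk]
    rw [← neg_sub x z, fderiv_normed_neg]
    ring
  -- Fubini for `ψ(x) k(x - z) f(z)`, which vanishes unless `|x| < R` and `|z| < R + 1`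
  have hkz : ∀ x ∈ Metric.ball (0 : EuclideanSpace ℝ (Fin d)) R, ∀ z,
      z ∉ Metric.closedBall (0 : EuclideanSpace ℝ (Fin d)) (R + 1) → k (x - z) = 0 := by
    intro x hx z hz
    have : x - z ∉ tsupport (φ.normed volume) := by
      rw [φ.tsupport_normed_eq, mem_closedBall_zero_iff, not_le]
      rw [mem_closedBall_zero_iff, not_le] at hz
      rw [mem_ball_zero_iff] at hx
      have := norm_sub_norm_le z x
      rw [norm_sub_rev] at this
      linarith
    simp only [hk]
    rw [image_eq_zero_of_notMem_tsupport (fun h => this (tsupport_fderiv_subset ℝ h))]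
    rfl
  have hfi : Integrable ((Metric.closedBall 0 (R + 1)).indicator f) volume :=
    (integrable_indicator_iff measurableSet_closedBall).2
      (hf.1.integrableOn_isCompact (isCompact_closedBall _ _))
  have hint : Integrable (Function.uncurry fun x z => ψ x * (k (x - z) * f z))
      (volume.prod volume) := by
    have h1 := (hψi.mul_prod hfi).bdd_mul (c := C)
      (f := fun p : EuclideanSpace ℝ (Fin d) × EuclideanSpace ℝ (Fin d) => k (p.1 - p.2))
      (by fun_prop) (Eventually.of_forall fun p => hC _)
    refine h1.congr (Eventually.of_forall fun p => ?_)
    by_cases hx : p.1 ∈ Metric.ball (0 : EuclideanSpace ℝ (Fin d)) R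
    · by_cases hz : p.2 ∈ Metric.closedBall (0 : EuclideanSpace ℝ (Fin d)) (R + 1)
      · simp only [Function.uncurry, indicator_of_mem hz]; ring
      · simp [Function.uncurry, hkz _ hx _ hz]
    · simp [Function.uncurry, hψ, indicator_of_notMem hx]
  have hswap : ∫ x, ψ x * g x = ∫ z, f z * divergence (fun z => (-Φ z) • v) z := by
    have e1 : ∀ x, ψ x * g x = ∫ z, ψ x * (k (x - z) * f z) := by
      intro x
      rw [integral_const_mul, hg]
      simp only
      rw [fderiv_normed_convolution_apply φ hf.1]
    have e2 : ∀ z, f z * divergence (fun z => (-Φ z) • v) z = ∫ x, ψ x * (k (x - z) * f z) := by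
      intro z
      rw [hdivΦ, ← integral_const_mul]
      congr 1; ext x; ring
    simp_rw [e1, e2]
    exact integral_integral_swap hint
  have habs : ∀ x, ψ x * g x = (Metric.ball 0 R).indicator (fun x => ‖g x‖) x := by
    intro x
    by_cases hx : x ∈ Metric.ball (0 : EuclideanSpace ℝ (Fin d)) R
    · simp only [hψ, indicator_of_mem hx, Real.norm_eq_abs]
      split_ifs with h
      · rw [abs_of_nonneg h, one_mul]
      · rw [abs_of_neg (not_le.1 h)]; ring
    · simp only [hψ, indicator_of_notMem hx, zero_mul]
  have hgi : IntegrableOn (fun x => ‖g x‖) (Metric.ball 0 R) volume :=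
    (hgc.norm.continuousOn.integrableOn_compact (isCompact_closedBall 0 R)).mono_set
      Metric.ball_subset_closedBall
  have hfin : ∫ x in Metric.ball 0 R, ‖g x‖ ≤ M := by
    rw [← integral_indicator measurableSet_ball]
    simp_rw [← habs]
    rw [hswap]
    exact htest
  calc ∫⁻ x in Metric.ball 0 R, ‖g x‖ₑ
      = ENNReal.ofReal (∫ x in Metric.ball 0 R, ‖g x‖) := by
        rw [ofReal_integral_eq_lintegral_ofReal hgi (Eventually.of_forall fun x => norm_nonneg _)]
        simp only [ofReal_norm]
    _ ≤ ENNReal.ofReal M := ENNReal.ofReal_le_ofReal hfin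

/-! ### Slices of functions of locally bounded variation -/

/-- The point of the plane with `i`-th coordinate `p.1` and other coordinate `p.2`. -/
noncomputable def planePoint (i : Fin 2) (p : ℝ × ℝ) : EuclideanSpace ℝ (Fin 2) :=
  p.1 • EuclideanSpace.single i 1 + p.2 • EuclideanSpace.single (i + 1) 1

@[simp] lemma planePoint_apply_self (i : Fin 2) (p : ℝ × ℝ) : planePoint i p i = p.1 := by
  fin_cases i <;> simp [planePoint]

@[simp] lemma planePoint_apply_add_one (i : Fin 2) (p : ℝ × ℝ) :
    planePoint i p (i + 1) = p.2 := by
  fin_cases i <;> simp [planePoint]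

lemma norm_planePoint_le (i : Fin 2) (p : ℝ × ℝ) : ‖planePoint i p‖ ≤ |p.1| + |p.2| :=
  (norm_add_le _ _).trans (by simp [norm_smul])

lemma measurePreserving_planePoint (i : Fin 2) :
    MeasurePreserving (planePoint i) (volume.prod volume) volume := by
  have h0 : MeasurePreserving
      (fun p : ℝ × ℝ => WithLp.toLp 2 ((MeasurableEquiv.finTwoArrow (α := ℝ)).symm p))
      (volume.prod volume) (volume : Measure (EuclideanSpace ℝ (Fin 2))) :=
    (PiLp.volume_preserving_toLp (Fin 2)).comp (volume_preserving_finTwoArrow ℝ).symm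
  fin_cases i
  · convert h0 using 1
    ext p j
    fin_cases j <;> simp [planePoint]
  · convert h0.comp (Measure.measurePreserving_swap (μ := volume) (ν := volume)) using 1
    ext p j
    fin_cases j <;> simp [planePoint]

lemma enorm_sub_le_setLIntegral_of_hasDerivAt {u u' : ℝ → ℝ} (hu : ∀ y, HasDerivAt u (u' y) y)
    (hc : Continuous u') {a b y z : ℝ} (hy : y ∈ Icc a b) (hz : z ∈ Icc a b) :
    ‖u y - u z‖ₑ ≤ ∫⁻ t in Icc a b, ‖u' t‖ₑ := by
  rw [← intervalIntegral.integral_eq_sub_of_hasDerivAt (fun t _ => hu t)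
    (hc.intervalIntegrable z y), ← ofReal_norm, intervalIntegral.norm_intervalIntegral_eq,
    ofReal_norm]
  refine (enorm_integral_le_lintegral_enorm _).trans (lintegral_mono_set ?_)
  exact uIoc_subset_uIcc.trans (uIcc_subset_Icc hz hy)

open scoped Convolution in
/-- On almost every line parallel to a coordinate axis, a `BV_loc` function of two variables is
essentially bounded on bounded segments. -/
lemma IsBVLoc.ae_exists_slice_bound {f : EuclideanSpace ℝ (Fin 2) → ℝ} (hf : IsBVLoc f)
    (i : Fin 2) {R : ℝ} (hR : 0 < R) :
    ∀ᵐ s, s ∈ Icc (-R) R → ∃ n : ℕ, ∀ᵐ y, y ∈ Icc (-R) R → |f (planePoint i (s, y))| ≤ n := by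
  obtain ⟨M, hM⟩ := hf.exists_lintegral_fderiv_convolution_le (i + 1) (2 * R + 1)
  let φ : ℕ → ContDiffBump (0 : EuclideanSpace ℝ (Fin 2)) := fun k =>
    ⟨1 / ((k : ℝ) + 1) / 2, 1 / ((k : ℝ) + 1), by positivity, half_lt_self (by positivity)⟩
  set e : EuclideanSpace ℝ (Fin 2) := EuclideanSpace.single (i + 1) 1 with he
  set g : ℕ → EuclideanSpace ℝ (Fin 2) → ℝ := fun k =>
    (φ k).normed volume ⋆[ContinuousLinearMap.lsmul ℝ ℝ, volume] f with hg
  have hgc : ∀ k, ContDiff ℝ 1 (g k) := fun k =>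
    (φ k).hasCompactSupport_normed.contDiff_convolution_left (ContinuousLinearMap.lsmul ℝ ℝ)
      ((φ k).contDiff_normed (n := 1)) hf.1
  have hgd : ∀ k, Continuous fun x => fderiv ℝ (g k) x e := fun k =>
    ((hgc k).continuous_fderiv one_ne_zero).clm_apply continuous_const
  have hP : Continuous (planePoint i) := by unfold planePoint; fun_prop
  -- the variation of the mollification `g k` on the segment `{s} × [-R, R]`
  set v : ℕ → ℝ → ℝ≥0∞ := fun k s =>
    ∫⁻ y in Icc (-R) R, ‖fderiv ℝ (g k) (planePoint i (s, y)) e‖ₑ with hv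
  have hmeas : ∀ k, Measurable fun p : ℝ × ℝ => ‖fderiv ℝ (g k) (planePoint i p) e‖ₑ :=
    fun k => ((hgd k).comp hP).enorm.measurable
  have hvm : ∀ k, Measurable (v k) := fun k => (hmeas k).lintegral_prod_right'
  have hvM : ∀ k, ∫⁻ s in Icc (-R) R, v k s ≤ ENNReal.ofReal M := by
    intro k
    have hk : (φ k).rOut ≤ 1 := by
      change 1 / ((k : ℝ) + 1) ≤ 1
      rw [div_le_one (by positivity)]
      linarith [(k.cast_nonneg : (0 : ℝ) ≤ k)]
    refine le_trans ?_ (hM (φ k) hk)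
    rw [← lintegral_prod _ (hmeas k).aemeasurable, Measure.prod_restrict,
      ← (measurePreserving_planePoint i).setLIntegral_comp_preimage measurableSet_ball
        (hgd k).enorm.measurable]
    refine lintegral_mono_set ?_
    rintro p ⟨h1, h2⟩
    rw [mem_preimage, mem_ball_zero_iff]
    have := norm_planePoint_le i p
    have := abs_le.2 h1
    have := abs_le.2 h2
    linarith
  have hfat : ∫⁻ s in Icc (-R) R, liminf (fun k => v k s) atTop ≤ ENNReal.ofReal M :=
    (lintegral_liminf_le hvm).trans
      (liminf_le_of_frequently_le' (Eventually.of_forall hvM).frequently)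
  have hfin := (ae_restrict_iff' measurableSet_Icc).1
    (ae_lt_top (Measurable.liminf hvm) (hfat.trans_lt ENNReal.ofReal_lt_top).ne)
  have hφ : Tendsto (fun k => (φ k).rOut) atTop (𝓝 0) := tendsto_one_div_add_atTop_nhds_zero_nat
  have hconv : ∀ᵐ x, Tendsto (fun k => g k x) atTop (𝓝 (f x)) :=
    ContDiffBump.ae_convolution_tendsto_right_of_locallyIntegrable hφ (K := 2)
      (Eventually.of_forall fun k => by
        change 1 / ((k : ℝ) + 1) ≤ 2 * (1 / ((k : ℝ) + 1) / 2)
        linarith) hf.1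
  have hconv' := Measure.ae_ae_of_ae_prod
    ((measurePreserving_planePoint i).quasiMeasurePreserving.ae hconv)
  filter_upwards [hfin, hconv'] with s hs hsc hsR
  -- a base point of the segment at which the mollifications converge
  obtain ⟨z, hz, hzR⟩ : ∃ z, Tendsto (fun k => g k (planePoint i (s, z))) atTop
      (𝓝 (f (planePoint i (s, z)))) ∧ z ∈ Icc (-R) R := by
    have hne : (ae (volume.restrict (Icc (-R) R))).NeBot := by
      rw [ae_neBot, Ne, Measure.restrict_eq_zero, Real.volume_Icc]
      simp only [ENNReal.ofReal_eq_zero, not_le]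
      linarith
    exact ((ae_restrict_of_ae hsc).and (ae_restrict_mem measurableSet_Icc)).exists
  obtain ⟨n, hn⟩ := exists_nat_ge ((liminf (fun k => v k s) atTop).toReal +
    |f (planePoint i (s, z))|)
  refine ⟨n, ?_⟩
  filter_upwards [hsc] with y hy hyR
  have hd : ∀ k y, HasDerivAt (fun y => g k (planePoint i (s, y)))
      (fderiv ℝ (g k) (planePoint i (s, y)) e) y := by
    intro k y
    have h1 : HasDerivAt (fun y => planePoint i (s, y)) e y := by
      unfold planePoint
      simpa using ((hasDerivAt_id y).smul_const e).const_add (s • EuclideanSpace.single i (1 : ℝ))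
    exact ((hgc k).differentiable one_ne_zero _).hasFDerivAt.comp_hasDerivAt y h1
  have hle : ‖f (planePoint i (s, y)) - f (planePoint i (s, z))‖ₑ ≤
      liminf (fun k => v k s) atTop := by
    rw [← ((hy.sub hz).enorm).liminf_eq]
    refine liminf_le_liminf (Eventually.of_forall fun k => ?_)
    exact enorm_sub_le_setLIntegral_of_hasDerivAt (hd k)
      ((hgd k).comp (hP.comp (by fun_prop))) hyR hzR
  have hle' := ENNReal.toReal_mono (hs hsR).ne hle
  rw [toReal_enorm, Real.norm_eq_abs] at hle'
  have := abs_sub_abs_le_abs_sub (f (planePoint i (s, y))) (f (planePoint i (s, z)))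
  linarith

/-- On a set of squares `max |z₀| |z₁| = r` with `r ∈ K ⊆ [R, R + 1]` of positive measure, the normal
component of a `BV_loc` vector field is essentially bounded by a common constant. At a corner both
components count as normal. -/
lemma IsBVLocField.exists_isCompact_bounded_slices
    {b : EuclideanSpace ℝ (Fin 2) → EuclideanSpace ℝ (Fin 2)} (hb : Measurable b)
    (hBV : IsBVLocField b) {R : ℝ} (hR : 0 ≤ R) :
    ∃ K ⊆ Icc R (R + 1), IsCompact K ∧ 0 < volume K ∧ ∃ n : ℕ,
      ∀ᵐ z, ∀ i, |z i| ∈ K → |z (i + 1)| ≤ |z i| → |b z i| ≤ n := by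
  set L := R + 1 with hL
  have hP : ∀ i, Measurable (planePoint i) := fun i => (measurePreserving_planePoint i).measurable
  have hbi : ∀ i, Measurable fun z => b z i := fun i => by fun_prop
  let S : Fin 2 → ℕ → Set ℝ := fun i n =>
    {s | ∀ᵐ y, y ∈ Icc (-L) L → |b (planePoint i (s, y)) i| ≤ n}
  have hSm : ∀ i n, MeasurableSet (S i n) := by
    intro i n
    have hB : MeasurableSet {p : ℝ × ℝ | ¬ (p.2 ∈ Icc (-L) L → |b (planePoint i p) i| ≤ n)} := by
      refine (MeasurableSet.imp (measurable_snd measurableSet_Icc) ?_).compl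
      exact measurableSet_le ((hbi i).comp (hP i)).abs measurable_const
    exact (measurable_measure_prodMk_left (ν := volume) hB) (measurableSet_singleton 0)
  have hSmono : ∀ i m n, m ≤ n → S i m ⊆ S i n := by
    intro i m n hmn s hs
    have hs' : ∀ᵐ y, y ∈ Icc (-L) L → |b (planePoint i (s, y)) i| ≤ m := hs
    change ∀ᵐ y, y ∈ Icc (-L) L → |b (planePoint i (s, y)) i| ≤ n
    filter_upwards [hs'] with y hy hyL
    exact (hy hyL).trans (by exact_mod_cast hmn)
  let A : ℕ → Set ℝ := fun n => Icc R (R + 1) ∩ ⋂ i, (S i n ∩ Neg.neg ⁻¹' S i n)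
  have hAm : ∀ n, MeasurableSet (A n) := fun n => measurableSet_Icc.inter
    (MeasurableSet.iInter fun i => (hSm i n).inter (measurable_neg (hSm i n)))
  have hcov : ∀ᵐ s, s ∈ Icc R (R + 1) → s ∈ ⋃ n, A n := by
    have h1 : ∀ᵐ s, ∀ i, s ∈ Icc (-L) L → ∃ n, s ∈ S i n :=
      ae_all_iff.2 fun i => (hBV i).ae_exists_slice_bound i (by linarith)
    have h2 := (Measure.measurePreserving_neg (volume : Measure ℝ)).quasiMeasurePreserving.ae h1
    filter_upwards [h1, h2] with s hs hs' hsR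
    choose n hn using fun i => hs i ⟨by linarith [hsR.1], hsR.2⟩
    choose m hm using fun i => hs' i ⟨by linarith [hsR.2], by linarith [hsR.1]⟩
    refine mem_iUnion.2 ⟨∑ i, (n i + m i), hsR, mem_iInter.2 fun i => ?_⟩
    have hi : n i + m i ≤ ∑ i, (n i + m i) :=
      Finset.single_le_sum (f := fun i => n i + m i) (fun _ _ => Nat.zero_le _)
        (Finset.mem_univ i)
    exact ⟨hSmono i _ _ (by omega) (hn i), hSmono i _ _ (by omega) (hm i)⟩
  obtain ⟨n, hn⟩ : ∃ n, 0 < volume (A n) := by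
    by_contra! h
    have h0 : volume (⋃ n, A n) = 0 := measure_iUnion_null fun n => le_antisymm (h n) zero_le
    have h1 : volume (Icc R (R + 1)) ≤ volume (⋃ n, A n) := measure_mono_ae hcov
    rw [h0, Real.volume_Icc] at h1
    simp at h1
  obtain ⟨K, hKA, hK, hKpos⟩ := (hAm n).exists_lt_isCompact hn
  refine ⟨K, hKA.trans inter_subset_left, hK, hKpos, n, ae_all_iff.2 fun i => ?_⟩
  have hm : MeasurableSet {z : EuclideanSpace ℝ (Fin 2) |
      |z i| ∈ K → |z (i + 1)| ≤ |z i| → |b z i| ≤ n} := by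
    refine MeasurableSet.imp ?_ (MeasurableSet.imp ?_ ?_)
    · exact (by fun_prop : Measurable fun z : EuclideanSpace ℝ (Fin 2) => |z i|) hK.measurableSet
    · exact measurableSet_le (by fun_prop) (by fun_prop)
    · exact measurableSet_le (hbi i).abs measurable_const
  rw [← (measurePreserving_planePoint i).map_eq, ae_map_iff (hP i).aemeasurable hm]
  refine (Measure.ae_prod_iff_ae_ae (hP i hm)).2 (Eventually.of_forall fun s => ?_)
  by_cases hs : |s| ∈ K
  · have hsA := hKA hs
    have hsS : s ∈ S i n := by
      have := mem_iInter.1 hsA.2 i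
      rcases abs_choice s with h | h
      · rw [← h]; exact this.1
      · have h2 : -|s| ∈ S i n := this.2
        rwa [h, neg_neg] at h2
    filter_upwards [hsS] with y hy
    simp only [planePoint_apply_self, planePoint_apply_add_one]
    exact fun _ hys => hy (abs_le.1 (hys.trans hsA.1.2))
  · simp [hs]

/-! ### Crossing squares along an absolutely continuous curve -/

lemma HasDerivAt.norm_le_of_eventually_norm_sub_le {E F : Type*} [NormedAddCommGroup E]
    [NormedSpace ℝ E] [NormedAddCommGroup F] [NormedSpace ℝ F] {u : ℝ → E} {w : ℝ → F} {u' : E}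
    {w' : F} {t : ℝ} (hu : HasDerivAt u u' t) (hw : HasDerivAt w w' t)
    (h : ∀ᶠ s in 𝓝 t, ‖u s - u t‖ ≤ ‖w s - w t‖) : ‖u'‖ ≤ ‖w'‖ := by
  refine le_of_tendsto_of_tendsto hu.tendsto_slope.norm hw.tendsto_slope.norm ?_
  filter_upwards [h.filter_mono nhdsWithin_le_nhds] with s hs
  simp only [slope, vsub_eq_sub, norm_smul]
  gcongr

lemma AbsolutelyContinuousOnInterval.of_dist_le {E F : Type*} [PseudoMetricSpace E]
    [PseudoMetricSpace F] {u : ℝ → E} {w : ℝ → F} {a b : ℝ}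
    (hw : AbsolutelyContinuousOnInterval w a b) (h : ∀ s t, dist (u s) (u t) ≤ dist (w s) (w t)) :
    AbsolutelyContinuousOnInterval u a b :=
  squeeze_zero (fun _ => Finset.sum_nonneg fun _ _ => dist_nonneg)
    (fun _ => Finset.sum_le_sum fun _ _ => h _ _) hw

/-- The Lebesgue measure of the part of `K` to the left of `s`. -/
noncomputable def leftMeasure (K : Set ℝ) (s : ℝ) : ℝ := volume.real (K ∩ Iic s)

lemma abs_leftMeasure_sub_le {K : Set ℝ} (hK : IsCompact K) (s t : ℝ) :
    |leftMeasure K s - leftMeasure K t| ≤ |s - t| := by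
  wlog hst : t ≤ s generalizing s t
  · rw [abs_sub_comm, abs_sub_comm s]
    exact this t s (le_of_not_ge hst)
  have hfin : ∀ r, volume (K ∩ Iic r) ≠ ∞ := fun r =>
    (measure_mono inter_subset_left |>.trans_lt hK.measure_lt_top).ne
  have h1 : leftMeasure K t ≤ leftMeasure K s :=
    measureReal_mono (inter_subset_inter_right _ (Iic_subset_Iic.2 hst)) (hfin s)
  have h2 : leftMeasure K s ≤ leftMeasure K t + volume.real (Ioc t s) := by
    refine (measureReal_mono ?_ (measure_union_lt_top (hfin t).lt_top
      measure_Ioc_lt_top).ne).trans (measureReal_union_le _ _)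
    intro r hr
    rcases le_or_gt r t with h | h
    · exact Or.inl ⟨hr.1, h⟩
    · exact Or.inr ⟨h, hr.2⟩
  rw [Real.volume_real_Ioc_of_le hst] at h2
  rw [abs_of_nonneg (by linarith), abs_of_nonneg (by linarith)]
  linarith

lemma eventually_leftMeasure_eq {K : Set ℝ} (hK : IsClosed K) {t : ℝ} (ht : t ∉ K) :
    ∀ᶠ s in 𝓝 t, leftMeasure K s = leftMeasure K t := by
  obtain ⟨δ, hδ, hball⟩ := Metric.mem_nhds_iff.1 (hK.isOpen_compl.mem_nhds ht)
  filter_upwards [Metric.ball_mem_nhds t hδ] with s hs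
  unfold leftMeasure
  congr 1
  ext r
  simp only [mem_inter_iff, mem_Iic, and_congr_right_iff]
  intro hr
  by_contra hne
  refine hball (?_ : r ∈ Metric.ball t δ) hr
  rw [Metric.mem_ball, Real.dist_eq] at hs ⊢
  refine lt_of_le_of_lt ?_ hs
  grind

/-- The sup norm on the plane. -/
noncomputable def planeSupNorm (z : EuclideanSpace ℝ (Fin 2)) : ℝ := max |z 0| |z 1|

lemma planeSupNorm_le_norm (z : EuclideanSpace ℝ (Fin 2)) : planeSupNorm z ≤ ‖z‖ :=
  max_le (PiLp.norm_apply_le z 0) (PiLp.norm_apply_le z 1)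

lemma norm_le_two_mul_planeSupNorm (z : EuclideanSpace ℝ (Fin 2)) : ‖z‖ ≤ 2 * planeSupNorm z := by
  have h : z = planePoint 0 (z 0, z 1) := by
    ext j
    fin_cases j <;> simp [planePoint]
  have h1 := norm_planePoint_le 0 (z 0, z 1)
  rw [← h] at h1
  have h2 : |z 0| ≤ planeSupNorm z := le_max_left _ _
  have h3 : |z 1| ≤ planeSupNorm z := le_max_right _ _
  simp only at h1
  linarith

lemma abs_planeSupNorm_sub_le_max (z w : EuclideanSpace ℝ (Fin 2)) :
    |planeSupNorm z - planeSupNorm w| ≤ max |z 0 - w 0| |z 1 - w 1| :=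
  (abs_max_sub_max_le_max _ _ _ _).trans
    (max_le_max (abs_abs_sub_abs_le _ _) (abs_abs_sub_abs_le _ _))

/-- A curve whose normal speed is at most `n` when it lies on one of the squares
`max |z₀| |z₁| = r`, `r ∈ K`, needs time `|K| / n` to cross all of them. -/
lemma abs_leftMeasure_planeSupNorm_sub_le
    {K : Set ℝ} (hK : IsCompact K) {n : ℝ} (hn : 0 ≤ n) {τ : ℝ}
    {γ γ' : ℝ → EuclideanSpace ℝ (Fin 2)}
    (hac : ∀ t ∈ Ico 0 τ, AbsolutelyContinuousOnInterval γ 0 t)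
    (hderiv : ∀ᵐ t, t ∈ Ioo 0 τ → HasDerivAt γ (γ' t) t)
    (hbound : ∀ᵐ t, t ∈ Ioo 0 τ →
      ∀ i, |γ t i| ∈ K → |γ t (i + 1)| ≤ |γ t i| → |γ' t i| ≤ n)
    {s t : ℝ} (hs : 0 ≤ s) (hst : s ≤ t) (ht : t < τ) :
    |leftMeasure K (planeSupNorm (γ t)) - leftMeasure K (planeSupNorm (γ s))| ≤ n * (t - s) := by
  set u : ℝ → ℝ := fun t => leftMeasure K (planeSupNorm (γ t)) with hu
  have hu1 : ∀ s t, |u s - u t| ≤ max |γ s 0 - γ t 0| |γ s 1 - γ t 1| := fun s t =>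
    (abs_leftMeasure_sub_le hK _ _).trans (abs_planeSupNorm_sub_le_max _ _)
  have huac : AbsolutelyContinuousOnInterval u s t := by
    refine ((hac t ⟨hs.trans hst, ht⟩).of_dist_le (u := u) fun a b => ?_).mono ?_
    · rw [Real.dist_eq, dist_eq_norm]
      refine (hu1 a b).trans ?_
      exact planeSupNorm_le_norm (γ a - γ b)
    · rw [uIcc_of_le hst, uIcc_of_le (hs.trans hst)]
      exact Icc_subset_Icc_left hs
  have hu' : ∀ᵐ r, r ∈ uIoc s t → ‖deriv u r‖ ≤ n := by
    filter_upwards [hderiv, hbound] with r hr hbr hrI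
    rw [uIoc_of_le hst] at hrI
    have hrτ : r ∈ Ioo 0 τ := ⟨hs.trans_lt hrI.1, hrI.2.trans_lt ht⟩
    specialize hr hrτ
    specialize hbr hrτ
    -- no chain rule is needed: where `u` is not differentiable, `deriv u r = 0`
    by_cases hdu : DifferentiableAt ℝ u r
    swap
    · rwa [deriv_zero_of_not_differentiableAt hdu, norm_zero]
    have hri : ∀ i, HasDerivAt (fun t => γ t i) (γ' r i) r := fun i =>
      (EuclideanSpace.proj i : EuclideanSpace ℝ (Fin 2) →L[ℝ] ℝ).hasFDerivAt.comp_hasDerivAt r hr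
    have hci : ∀ i, ContinuousAt (fun t => |γ t i|) r := fun i => (hri i).continuousAt.abs
    by_cases hK' : planeSupNorm (γ r) ∈ K
    swap
    · -- off `K` the function `leftMeasure K` is locally constant
      have hcont : ContinuousAt (fun t => planeSupNorm (γ t)) r := (hci 0).max (hci 1)
      have h0 := hdu.hasDerivAt.norm_le_of_eventually_norm_sub_le (hasDerivAt_const r (0 : ℝ)) <| by
        filter_upwards [hcont.eventually (eventually_leftMeasure_eq hK.isClosed hK')] with a ha
        simp [hu, ha]
      exact h0.trans (by simpa using hn)
    -- off the diagonals only one coordinate moves the square; on a diagonal both of them may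
    rcases lt_trichotomy |γ r 0| |γ r 1| with h | h | h
    · have hm : planeSupNorm (γ r) = |γ r 1| := max_eq_right h.le
      rw [hm] at hK'
      refine (hdu.hasDerivAt.norm_le_of_eventually_norm_sub_le (hri 1) ?_).trans (hbr 1 hK' h.le)
      filter_upwards [(hci 0).eventually_lt (hci 1) h] with a ha
      refine (abs_leftMeasure_sub_le hK _ _).trans ?_
      rw [hm, planeSupNorm, max_eq_right ha.le]
      exact abs_abs_sub_abs_le _ _
    · have hm : planeSupNorm (γ r) = |γ r 0| := max_eq_left h.ge
      rw [hm] at hK'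
      have h0 : |γ' r 0| ≤ n := hbr 0 hK' h.ge
      have h1 : |γ' r 1| ≤ n := hbr 1 (h ▸ hK') h.le
      exact (hdu.hasDerivAt.norm_le_of_eventually_norm_sub_le ((hri 0).prodMk (hri 1))
        (Eventually.of_forall fun a => hu1 a r)).trans (max_le h0 h1)
    · have hm : planeSupNorm (γ r) = |γ r 0| := max_eq_left h.le
      rw [hm] at hK'
      refine (hdu.hasDerivAt.norm_le_of_eventually_norm_sub_le (hri 0) ?_).trans (hbr 0 hK' h.le)
      filter_upwards [(hci 1).eventually_lt (hci 0) h] with a ha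
      refine (abs_leftMeasure_sub_le hK _ _).trans ?_
      rw [hm, planeSupNorm, max_eq_left ha.le]
      exact abs_abs_sub_abs_le _ _
  rw [← huac.integral_deriv_eq_sub]
  refine (intervalIntegral.norm_integral_le_of_norm_le_const_ae hu').trans ?_
  rw [abs_of_nonneg (sub_nonneg.2 hst)]

/-! ### Null sets along a maximal regular flow -/

lemma exitTime_le {d : ℕ} {X : ℝ → EuclideanSpace ℝ (Fin d) → EuclideanSpace ℝ (Fin d)}
    {TX : EuclideanSpace ℝ (Fin d) → ℝ} {Ω' : Set (EuclideanSpace ℝ (Fin d))}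
    {x : EuclideanSpace ℝ (Fin d)} (hx : 0 ≤ TX x) : exitTime X TX Ω' x ≤ TX x := by
  unfold exitTime hittingTime
  split_ifs
  · exact Real.sSup_le (fun t ht => ht.2.1.le) hx
  · exact hx

lemma potential_ball_le {d : ℕ} {r : ℝ} {x : EuclideanSpace ℝ (Fin d)} (hx : ‖x‖ ≤ r) {R : ℝ}
    (hR : r + 1 ≤ R) : potential (Metric.ball 0 R) x ≤ max 1 (ENNReal.ofReal r) := by
  refine max_le_max ?_ ?_
  · rw [ENNReal.inv_le_one, Metric.le_infEDist]
    intro y hy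
    rw [mem_compl_iff, mem_ball_zero_iff, not_lt] at hy
    rw [edist_dist, ENNReal.one_le_ofReal, dist_comm, dist_eq_norm]
    linarith [norm_sub_norm_le y x]
  · rw [← ofReal_norm]
    exact ENNReal.ofReal_le_ofReal hx

/-- A trajectory is bounded on `[0, t]` for `t` less than its life time, so it leaves a large enough
ball only after time `t`. -/
lemma exists_lt_exitTime_ball {d : ℕ}
    {X : ℝ → EuclideanSpace ℝ (Fin d) → EuclideanSpace ℝ (Fin d)}
    {TX : EuclideanSpace ℝ (Fin d) → ℝ} {x : EuclideanSpace ℝ (Fin d)} (h0 : X 0 x = x)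
    (hc : ∀ t ∈ Ico 0 (TX x), AbsolutelyContinuousOnInterval (fun s => X s x) 0 t)
    {t : ℝ} (ht0 : 0 ≤ t) (ht : t < TX x) :
    ∃ m : ℕ, t < exitTime X TX (Metric.ball 0 m) x := by
  obtain ⟨t', htt', ht'⟩ := exists_between ht
  have ht'0 : 0 ≤ t' := ht0.trans htt'.le
  obtain ⟨r, hr⟩ := (hc t' ⟨ht'0, ht'⟩).exists_bound
  rw [uIcc_of_le ht'0] at hr
  obtain ⟨m, hm⟩ := exists_nat_ge (r + 1)
  refine ⟨m, htt'.trans_le ?_⟩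
  have hx : x ∈ Metric.ball (0 : EuclideanSpace ℝ (Fin d)) m := by
    have := hr 0 ⟨le_rfl, ht'0⟩
    rw [h0] at this
    rw [mem_ball_zero_iff]
    linarith
  rw [exitTime, if_pos hx]
  refine le_csSup ⟨TX x, fun s hs => hs.2.1.le⟩ ⟨ht'0, ht', ?_⟩
  refine lt_of_le_of_lt (iSup₂_le fun s hs => potential_ball_le (hr s hs) hm) ?_
  exact max_lt ENNReal.one_lt_top ENNReal.ofReal_lt_top

/-- Almost every trajectory of a maximal regular flow meets a given null set for almost no time. -/
lemma IsMaximalRegularFlow.ae_ae_notMem_of_null {d : ℕ}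
    {b : ℝ → EuclideanSpace ℝ (Fin d) → EuclideanSpace ℝ (Fin d)} {T : ℝ}
    {X : ℝ → EuclideanSpace ℝ (Fin d) → EuclideanSpace ℝ (Fin d)}
    {TX : EuclideanSpace ℝ (Fin d) → ℝ} (hX : IsMaximalRegularFlow b T univ X TX)
    {N : Set (EuclideanSpace ℝ (Fin d))} (hN : MeasurableSet N) (hN0 : volume N = 0) :
    ∀ᵐ x, ∀ᵐ t : ℝ, t ∈ Ico 0 (TX x) → X t x ∉ N := by
  have hTX : Measurable TX := hX.measurable_time.comp (measurable_id.subtype_mk (h := mem_univ))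
  have hcurve := hX.integral_curve
  rw [Measure.restrict_univ] at hcurve
  have hfix : ∀ t : ℝ, ∀ᵐ x, t ∈ Ico 0 (TX x) → X t x ∉ N := by
    intro t
    by_cases ht : t ∈ Icc 0 T
    swap
    · exact Eventually.of_forall fun x hx =>
        absurd ⟨hx.1, hx.2.le.trans (hX.time_mem x (mem_univ x)).2⟩ ht
    -- without this measurability the push-forward in `compression` would be the junk value `0`
    have hXt : AEMeasurable (X t) (volume.restrict {x | t < TX x}) := by
      refine aemeasurable_restrict_of_measurable_subtype (measurableSet_lt measurable_const hTX) ?_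
      exact hX.measurable_flow.comp
        (f := fun x : {x | t < TX x} => (⟨(t, x.1), mem_univ _, ht.1, x.2⟩ :
          {p : ℝ × EuclideanSpace ℝ (Fin d) // p.2 ∈ univ ∧ 0 ≤ p.1 ∧ p.1 < TX p.2}))
        (by fun_prop)
    have hball : ∀ m : ℕ, ∀ᵐ x, t < exitTime X TX (Metric.ball 0 m) x → X t x ∉ N := by
      intro m
      obtain ⟨C, hC⟩ := hX.compression (Metric.ball 0 m) ⟨Metric.isOpen_ball,
        (isCompact_closedBall 0 (m : ℝ)).of_isClosed_subset isClosed_closure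
          Metric.closure_ball_subset_closedBall, subset_univ _⟩
      have hsub : {x | t < exitTime X TX (Metric.ball 0 m) x} ⊆ {x | t < TX x} := fun x hx =>
        lt_of_lt_of_le hx (exitTime_le (hX.time_mem x (mem_univ x)).1.le)
      refine ae_imp_of_ae_restrict (ae_of_ae_map (hXt.mono_set hsub) (p := fun y => y ∉ N) ?_)
      refine (Measure.absolutelyContinuous_of_le_smul (hC t ht)).ae_le ?_
      exact ae_restrict_of_ae (measure_eq_zero_iff_ae_notMem.1 hN0)
    filter_upwards [hcurve, ae_all_iff.2 hball] with x hx hxm hxt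
    obtain ⟨m, hm⟩ := exists_lt_exitTime_ball hx.2.2.2 hx.2.1 hxt.1 hxt.2
    exact hxm m hm
  refine (Measure.ae_ae_comm (p := fun t x => t ∈ Ico 0 (TX x) → X t x ∉ N) ?_).1
    (Eventually.of_forall hfix)
  have hD : MeasurableSet {p : ℝ × EuclideanSpace ℝ (Fin d) |
      p.2 ∈ univ ∧ 0 ≤ p.1 ∧ p.1 < TX p.2} := by
    have h := (measurableSet_le (measurable_const (a := (0 : ℝ))) measurable_fst).inter
      (measurableSet_lt measurable_fst (hTX.comp measurable_snd))
    convert h using 1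
    ext p
    simp
  convert (hD.subtype_image (hX.measurable_flow hN)).compl using 1
  ext p
  simp only [mem_compl_iff, mem_image, Subtype.exists, mem_preimage]
  constructor
  · rintro h ⟨q, hq, hqN, rfl⟩
    exact h hq.2 hqN
  · intro h hp hpN
    exact h ⟨p, ⟨mem_univ _, hp.1, hp.2⟩, hpN, rfl⟩

/-! ### Absence of oscillation -/

theorem proposition7p4
    (b : EuclideanSpace ℝ (Fin 2) → EuclideanSpace ℝ (Fin 2)) (hb : Measurable b)
    (hBV : IsBVLocField b) (hdiv : HasDivLInftyLoc b)
    (T : ℝ) (hT : 0 < T)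
    (X : ℝ → EuclideanSpace ℝ (Fin 2) → EuclideanSpace ℝ (Fin 2))
    (TX : EuclideanSpace ℝ (Fin 2) → ℝ)
    (hX : IsMaximalRegularFlow (fun _ => b) T Set.univ X TX) :
    ∀ᵐ x : EuclideanSpace ℝ (Fin 2),
      limsup (fun t => ‖X t x‖ₑ) (𝓝[<] (TX x)) = ∞ →
        liminf (fun t => ‖X t x‖ₑ) (𝓝[<] (TX x)) = ∞ := by
  choose K hKR hK hKpos n hn using fun R : ℕ =>
    hBV.exists_isCompact_bounded_slices hb (R.cast_nonneg : (0 : ℝ) ≤ R)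
  have hspeed : ∀ R, ∀ᵐ x, ∀ᵐ t : ℝ, t ∈ Ico 0 (TX x) → ∀ i, |X t x i| ∈ K R →
      |X t x (i + 1)| ≤ |X t x i| → |b (X t x) i| ≤ n R := by
    intro R
    obtain ⟨N, hsub, hN, hN0⟩ := exists_measurable_superset_of_null (hn R)
    filter_upwards [hX.ae_ae_notMem_of_null hN hN0] with x hx
    filter_upwards [hx] with t ht htI
    by_contra h
    exact ht htI (hsub h)
  have hcurve := hX.integral_curve
  rw [Measure.restrict_univ] at hcurve
  filter_upwards [hcurve, ae_all_iff.2 hspeed] with x hx hxs hsup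
  by_contra hinf
  have hτ : 0 < TX x := (hX.time_mem x (mem_univ x)).1
  obtain ⟨R, hR⟩ := ENNReal.exists_nat_gt hinf
  have hlow := frequently_lt_of_liminf_lt (by isBoundedDefault) hR
  have hhigh : ∃ᶠ t in 𝓝[<] (TX x), ENNReal.ofReal (2 * (R + 1)) < ‖X t x‖ₑ :=
    frequently_lt_of_lt_limsup (by isBoundedDefault) (hsup ▸ ENNReal.ofReal_lt_top)
  set V := volume.real (K R) with hV
  have hVpos : 0 < V := ENNReal.toReal_pos (hKpos R).ne' (hK R).measure_lt_top.ne
  have hlip : ∀ s t, 0 ≤ s → s ≤ t → t < TX x →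
      |leftMeasure (K R) (planeSupNorm (X t x)) - leftMeasure (K R) (planeSupNorm (X s x))| ≤
        n R * (t - s) := by
    intro s t hs hst ht
    refine abs_leftMeasure_planeSupNorm_sub_le (hK R) (n R).cast_nonneg hx.2.1
      ((ae_restrict_iff' measurableSet_Ioo).1 hx.2.2.1) ?_ hs hst ht
    filter_upwards [hxs R] with r hr hrI
    exact hr ⟨hrI.1.le, hrI.2⟩
  -- within time `δ` the function `leftMeasure (K R) (planeSupNorm (X · x))` cannot increase by `V`
  set δ := V / (n R + 1) with hδ
  have hδpos : 0 < δ := by positivity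
  have hnear : ∀ᶠ t in 𝓝[<] (TX x), t ∈ Ioo (max 0 (TX x - δ)) (TX x) :=
    Ioo_mem_nhdsLT (max_lt hτ (by linarith))
  obtain ⟨s, hsl, hs⟩ := (hlow.and_eventually hnear).exists
  obtain ⟨t, hth, ht⟩ := (hhigh.and_eventually hnear).exists
  have hs0 : leftMeasure (K R) (planeSupNorm (X s x)) = 0 := by
    have h1 : planeSupNorm (X s x) < R := by
      refine (planeSupNorm_le_norm _).trans_lt ?_
      rw [← ofReal_norm, ← ENNReal.ofReal_natCast] at hsl
      exact lt_of_not_ge fun h => hsl.not_ge (ENNReal.ofReal_le_ofReal h)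
    have h2 : K R ∩ Iic (planeSupNorm (X s x)) = ∅ := by
      ext r
      simp only [mem_inter_iff, mem_Iic, mem_empty_iff_false, iff_false, not_and, not_le]
      exact fun hr => h1.trans_le (hKR R hr).1
    simp [leftMeasure, h2]
  have ht0 : leftMeasure (K R) (planeSupNorm (X t x)) = V := by
    have h1 : R + 1 < planeSupNorm (X t x) := by
      rw [← ofReal_norm] at hth
      have := lt_of_not_ge fun h => hth.not_ge (ENNReal.ofReal_le_ofReal h)
      linarith [norm_le_two_mul_planeSupNorm (X t x)]
    have h2 : K R ∩ Iic (planeSupNorm (X t x)) = K R :=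
      inter_eq_left.2 fun r hr => (hKR R hr).2.trans h1.le
    rw [leftMeasure, h2]
  have hnδ : (n R : ℝ) * δ < V := by
    have : ((n R : ℝ) + 1) * δ = V := by rw [hδ]; field_simp
    linarith
  have hs1 := max_lt_iff.1 hs.1
  have ht1 := max_lt_iff.1 ht.1
  have hVle : V ≤ n R * δ := by
    rcases le_total s t with h | h
    · have := hlip s t hs1.1.le h ht.2
      rw [hs0, ht0, sub_zero, abs_of_pos hVpos] at this
      exact this.trans (by gcongr; linarith [ht.2])
    · have := hlip t s ht1.1.le h hs.2
      rw [hs0, ht0, zero_sub, abs_neg, abs_of_pos hVpos] at this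
      exact this.trans (by gcongr; linarith [hs.2])
  exact hnδ.not_ge hVle
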